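/- Let $K$ be a commutative locally compact (Hausdorff) hypergroup with convolution $(x,y)\mapsto\omega(x,y)$ (where each $\omega(x,y)=\delta_x*\delta_y$ is a regular Borel probability measure on $K$ with compact support), involution $x\mapsto\tilde x$ and unit $e$, and let $m$ be a Haar measure on $K$, i.e. a nonzero Radon measure with $\int_K T_xf\,dm=\int_K f\,dm$ for all $x\in K$, $f\in C_c(K)$, where $T_xf(y):=\int_K f\,d\omega(x,y)$. Write $L^1(K)=L^1(K,m)$ and $L^\infty(K)=L^1(K)^*$ for the spaces of complex-valued integrable, respectively essentially bounded, functions, with the convolution $f*g(x)=\int_K f(y)\,T_{\tilde y}g(x)\,dm(y)$ on $L^1(K)$. Let $$\widehat K=\{\alpha\in C^b(K):\ \alpha\neq 0,\ \textstyle\int_K\alpha\,d\omega(x,y)=\alpha(x)\alpha(y)\ \text{and}\ \alpha(\tilde x)=\overline{\alpha(x)}\ \text{for all } x,y\in K\},$$ and for $f\in L^1(K)$, $\alpha\in\widehat K$ put $\widehat f(\alpha)=\int_K\overline{\alpha(x)}f(x)\,dm(x)$. Let $\alpha\in\widehat K$. Suppose that $K$ is $\alpha$-amenable, i.e. there is a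 bounded linear functional $m_\alpha$ on $L^\infty(K)$ with $m_\alpha(\alpha)=1$ and $m_\alpha(T_xf)=\alpha(x)\,m_\alpha(f)$ for all $f\in L^\infty(K)$ and $x\in K$. Then every $\alpha$-derivation on $L^1(K)$ is zero: if $D\in L^1(K)^*$ is a bounded linear functional with $$D(f*g)=\widehat f(\alpha)\,D(g)+\widehat g(\alpha)\,D(f)\qquad\text{for all } f,g\in L^1(K),$$ then $D=0$. -/

import Mathlib

open MeasureTheory Topology
open scoped ENNReal BoundedContinuousFunction ComplexConjugate

/-- A (locally compact) hypergroup `(K, ω, ~)`: a locally compact Hausdorff space `K` together with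
a convolution `ω : K × K → M¹(K)` into the regular Borel probability measures, an involution `~`
and a unit `e`. -/
class Hypergroup (K : Type*) [TopologicalSpace K] [T2Space K] [LocallyCompactSpace K]
    [MeasurableSpace K] [BorelSpace K] where
  /-- the convolution `ω(x, y) = δ_x * δ_y` of two point measures -/
  ω : K → K → Measure K
  /-- the involution `x ↦ x̃` -/
  tilde : K → K
  /-- the unit -/
  e : K
  isProbabilityMeasure_ω : ∀ x y, IsProbabilityMeasure (ω x y)
  regular_ω : ∀ x y, (ω x y).Regular
  /-- `(x, y) ↦ ω(x, y)` is continuous for the weak topology on `M¹(K)` -/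
  continuous_ω : ∀ f : K →ᵇ ℂ, Continuous fun p : K × K => ∫ t, f t ∂(ω p.1 p.2)
  /-- associativity `ω(x, ω(y, z)) = ω(ω(x, y), z)`, tested on bounded continuous functions -/
  assoc_ω : ∀ (x y z : K) (f : K →ᵇ ℂ),
    ∫ t, (∫ s, f s ∂(ω x t)) ∂(ω y z) = ∫ t, (∫ s, f s ∂(ω t z)) ∂(ω x y)
  isCompact_support_ω : ∀ x y, IsCompact (ω x y).support
  /-- `(x, y) ↦ supp ω(x, y)` is continuous for the Michael topology on the nonempty compact
  subsets of `K`, which is generated by the sets `{A | A ⊆ U}` and `{A | A ∩ U ≠ ∅}`,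
  `U` open -/
  isOpen_support_subset : ∀ U : Set K, IsOpen U → IsOpen {p : K × K | (ω p.1 p.2).support ⊆ U}
  isOpen_support_inter : ∀ U : Set K, IsOpen U →
    IsOpen {p : K × K | ((ω p.1 p.2).support ∩ U).Nonempty}
  ω_e : ∀ x, ω x e = Measure.dirac x
  e_ω : ∀ x, ω e x = Measure.dirac x
  continuous_tilde : Continuous tilde
  tilde_tilde : ∀ x, tilde (tilde x) = x
  map_tilde_ω : ∀ x y, (ω x y).map tilde = ω (tilde y) (tilde x)
  e_mem_support_iff : ∀ x y, e ∈ (ω x y).support ↔ x = tilde y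

namespace Hypergroup

section

variable {K : Type*} [TopologicalSpace K] [T2Space K] [LocallyCompactSpace K]
  [MeasurableSpace K] [BorelSpace K] [Hypergroup K]

/-- The translate `T_x f (y) = ∫ f dω(x, y)`. -/
noncomputable def translate (x : K) (f : K → ℂ) (y : K) : ℂ := ∫ t, f t ∂(ω x y)

variable (K) in
/-- `K` is commutative. -/
def IsCommutative : Prop := ∀ x y : K, ω x y = ω y x

/-- `m` is a Haar measure on the (commutative) hypergroup `K`: a nonzero Radon measure which is
invariant under the translations `T_x`. "Radon" is taken in the form "finite on compact sets, and
inner regular by compact sets on every Borel set". For this version of the Haar measure null sets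
and locally null sets coincide, so that `Lp ℂ ∞ m` is the dual of `Lp ℂ 1 m` also if
`K` is not `σ`-compact. -/
structure IsHaarMeasure (m : Measure K) : Prop where
  ne_zero : m ≠ 0
  isFiniteMeasureOnCompacts : IsFiniteMeasureOnCompacts m
  innerRegular : m.InnerRegular
  integral_translate : ∀ (x : K) (f : K → ℂ), Continuous f → HasCompactSupport f →
    ∫ y, translate x f y ∂m = ∫ y, f y ∂m

/-- `α` belongs to the dual `K̂`: it is a nonzero bounded continuous function which is
multiplicative and hermitian. -/
structure IsCharacter (α : K →ᵇ ℂ) : Prop where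
  ne_zero : α ≠ 0
  integral_ω : ∀ x y : K, ∫ t, α t ∂(ω x y) = α x * α y
  map_tilde : ∀ x : K, α (tilde x) = conj (α x)

/-- The convolution `(f * g)(x) = ∫ f(y) T_ỹ g (x) dm(y)`. -/
noncomputable def convolution (m : Measure K) (f g : K → ℂ) (x : K) : ℂ :=
  ∫ y, f y * translate (tilde y) g x ∂m

/-- The Fourier transform `f̂(α) = ∫ conj(α(x)) f(x) dm(x)`. -/
noncomputable def fourier (m : Measure K) (f : K → ℂ) (α : K →ᵇ ℂ) : ℂ :=
  ∫ x, conj (α x) * f x ∂m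

/-- The class in `L^∞(K)` of a bounded continuous function. -/
noncomputable def toLinfty (m : Measure K) (f : K →ᵇ ℂ) : Lp ℂ ∞ m :=
  (memLp_top_of_bound f.continuous.aestronglyMeasurable ‖f‖
    (Filter.Eventually.of_forall f.norm_coe_le_norm)).toLp f

/-- `K` is `α`-amenable: there is a bounded linear functional `M` on `L^∞(K)` with `M(α) = 1` and
`M(T_x f) = α(x) M(f)` for all `f ∈ L^∞(K)` and `x ∈ K`. The element `T_x f` of `L^∞(K)` appears
as the element `g` which is almost everywhere equal to the translate of `f`. -/
def IsAmenable (m : Measure K) (α : K →ᵇ ℂ) : Prop :=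
  ∃ M : StrongDual ℂ (Lp ℂ ∞ m), M (toLinfty m α) = 1 ∧
    ∀ (x : K) (f g : Lp ℂ ∞ m), (g =ᵐ[m] translate x f) → M g = α x * M f

/-- `D ∈ L¹(K)^*` is an `α`-derivation: `D(f * g) = f̂(α) D(g) + ĝ(α) D(f)` for all
`f, g ∈ L¹(K)`. The element `f * g` of `L¹(K)` appears as the element `h` which is almost everywhere
equal to the convolution of `f` and `g`. -/
def IsDerivation (m : Measure K) (α : K →ᵇ ℂ) (D : StrongDual ℂ (Lp ℂ 1 m)) : Prop :=
  ∀ f g h : Lp ℂ 1 m, (h =ᵐ[m] convolution m f g) →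
    D h = fourier m f α * D g + fourier m g α * D f

end

end Hypergroup

/-! Fix `g` in `C_c(K)` with `ĝ(α) = 1`. Since `(T_x f) * g = f * (T_x g)`, evaluating `D` on both
sides gives `D(T_x f) = α(x) D(f) + f̂(α) φ(x)` with `φ(x) = D(T_x g) - α(x) D(g)`
(`IsDerivation.evalL1_T`). For `f = T_y g`, together with `D(T_y T_x g) = ∫ D(T_t g) dω(x, y)(t)`
(`evalL1_T_T`), this says that the bounded continuous function `φ` satisfies `T_x φ = α(x) φ + φ(x)
α`. The functional `M` of `α`-amenability turns this into `α(x) M(φ) = α(x) M(φ) + φ(x)`, so `φ = 0`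
and `D(T_x g) = α(x) D(g)`. Integrating over translates, `D(f * g) = f̂(α) D(g)`; the derivation
rule then leaves `ĝ(α) D(f) = D(f) = 0` on `C_c(K)`, which is dense in `L¹`.

Most of the work is in facts that the invariance of `m` does not state. The adjoint formula `∫ T_x f
· g = ∫ f · T_x̃ g` (`IsHaarMeasure.integral_T_mul`) comes from an approximate identity at `e`.
Translation and reflection preserve null sets (`IsHaarMeasure.ae_ω_eq_zero`,
`IsHaarMeasure.measure_preimage_tilde`), so convolution makes sense on classes. Finally, `D` passes
under integrals of compactly supported continuous families (`evalL1_integral`). -/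

namespace Hypergroup

attribute [instance] isProbabilityMeasure_ω regular_ω

/-! ### Supports of `ω(x, y)` and translates of continuous functions -/

section Topology

variable {K : Type*} [TopologicalSpace K]

theorem integral_pos_of_mem_support [MeasurableSpace K] {μ : Measure K} {r : K → ℝ}
    (hr : Continuous r) (hi : Integrable r μ) (h0 : ∀ x, 0 ≤ r x) {a : K} (ha : a ∈ μ.support)
    (hra : 0 < r a) : 0 < ∫ t, r t ∂μ := by
  rw [integral_pos_iff_support_of_nonneg h0 hi]
  exact (Measure.mem_support_iff_forall a).1 ha _
    ((isOpen_ne_fun hr continuous_const).mem_nhds hra.ne')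

/-- Urysohn's lemma with values in the bounded continuous functions. -/
theorem exists_urysohn [T2Space K] [LocallyCompactSpace K] {L U : Set K} (hL : IsCompact L) (hU : IsOpen U) (hLU : L ⊆ U) :
    ∃ (f : K →ᵇ ℂ) (r : K → ℝ), Continuous r ∧ HasCompactSupport r ∧ HasCompactSupport f ∧
      (∀ x, f x = r x) ∧ (∀ x, 0 ≤ r x) ∧ (∀ x, r x ≤ 1) ∧ (∀ x ∈ L, r x = 1) ∧
      ∀ x, x ∉ U → r x = 0 := by
  obtain ⟨r, h1, h0, hc, hb⟩ := exists_continuous_one_zero_of_isCompact hL hU.isClosed_compl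
    (Set.disjoint_compl_right_iff_subset.2 hLU)
  refine ⟨BoundedContinuousFunction.ofNormedAddCommGroup (fun x => (r x : ℂ))
    (Complex.continuous_ofReal.comp r.continuous) 1 fun x => ?_, r, r.continuous, hc, ?_,
    fun x => rfl, fun x => (hb x).1, fun x => (hb x).2, fun x hx => h1 hx, fun x hx => h0 hx⟩
  · rw [Complex.norm_real, Real.norm_eq_abs, abs_of_nonneg (hb x).1]
    exact (hb x).2
  · exact hc.comp_left (g := ((↑) : ℝ → ℂ)) Complex.ofReal_zero

/-- A continuous function with compact support is a bounded continuous function. -/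
theorem exists_boundedContinuous_eq {f : K → ℂ} (hf : Continuous f) (hc : HasCompactSupport f) :
    ∃ F : K →ᵇ ℂ, ⇑F = f := by
  obtain ⟨C, hC⟩ := hc.exists_bound_of_continuous hf
  exact ⟨BoundedContinuousFunction.ofNormedAddCommGroup f hf C hC, rfl⟩

variable [T2Space K] [LocallyCompactSpace K] [MeasurableSpace K] [BorelSpace K] [Hypergroup K]

theorem ae_mem_support (x y : K) : ∀ᵐ t ∂(ω x y), t ∈ (ω x y).support :=
  Measure.support_mem_ae_of_regular

theorem integral_ω_congr {E : Type*} [NormedAddCommGroup E] [NormedSpace ℝ E] {x y : K}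
    {f g : K → E} (h : ∀ t ∈ (ω x y).support, f t = g t) : ∫ t, f t ∂(ω x y) = ∫ t, g t ∂(ω x y) :=
  integral_congr_ae ((ae_mem_support x y).mono h)

theorem norm_integral_ω_le {x y : K} {f : K → ℂ} {C : ℝ}
    (h : ∀ t ∈ (ω x y).support, ‖f t‖ ≤ C) : ‖∫ t, f t ∂(ω x y)‖ ≤ C := by
  simpa using norm_integral_le_of_norm_le_const ((ae_mem_support x y).mono h)

/-- The translate of a bounded continuous function, as a bounded continuous function. -/
noncomputable def T (x : K) (f : K →ᵇ ℂ) : K →ᵇ ℂ :=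
  BoundedContinuousFunction.ofNormedAddCommGroup (fun y => ∫ t, f t ∂(ω x y))
    ((continuous_ω f).comp (Continuous.prodMk_right x)) ‖f‖
    fun _ => norm_integral_ω_le fun t _ => f.norm_coe_le_norm t

theorem T_apply (x : K) (f : K →ᵇ ℂ) (y : K) : T x f y = ∫ t, f t ∂(ω x y) := rfl

theorem translate_eq_T (x : K) (f : K →ᵇ ℂ) : translate x f = T x f := rfl

theorem continuous_T (f : K →ᵇ ℂ) : Continuous fun p : K × K => T p.1 f p.2 := continuous_ω f

theorem integrable_ω (f : K →ᵇ ℂ) (x y : K) : Integrable f (ω x y) := f.integrable _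

theorem T_e (f : K →ᵇ ℂ) : T e f = f := by
  ext y; rw [T_apply, e_ω, integral_dirac]

theorem T_comm (hK : IsCommutative K) (f : K →ᵇ ℂ) (x y : K) : T x f y = T y f x := by
  rw [T_apply, T_apply, hK]

theorem T_T_apply (x y z : K) (f : K →ᵇ ℂ) : T x (T y f) z = ∫ t, T t f z ∂(ω y x) :=
  assoc_ω y x z f

theorem T_T_comm (hK : IsCommutative K) (x y : K) (f : K →ᵇ ℂ) : T x (T y f) = T y (T x f) := by
  ext z; rw [T_T_apply, T_T_apply, hK]

theorem T_ofReal {f : K →ᵇ ℂ} {r : K → ℝ} (hf : ∀ x, f x = r x) (x y : K) :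
    T x f y = ((∫ t, r t ∂(ω x y) : ℝ) : ℂ) := by
  rw [T_apply, ← integral_complex_ofReal]
  exact integral_congr_ae (.of_forall hf)

/-- The composition of a bounded continuous function with the involution. -/
noncomputable def reflect (f : K →ᵇ ℂ) : K →ᵇ ℂ := f.compContinuous ⟨tilde, continuous_tilde⟩

theorem reflect_apply (f : K →ᵇ ℂ) (x : K) : reflect f x = f (tilde x) := rfl

theorem reflect_reflect (f : K →ᵇ ℂ) : reflect (reflect f) = f := by
  ext x; simp [reflect_apply, tilde_tilde]

theorem reflect_T (hK : IsCommutative K) (x : K) (f : K →ᵇ ℂ) :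
    reflect (T x f) = T (tilde x) (reflect f) := by
  ext y
  rw [reflect_apply, T_apply, T_apply, hK (tilde x) y, ← tilde_tilde y, ← map_tilde_ω,
    integral_map continuous_tilde.aemeasurable (reflect f).continuous.aestronglyMeasurable]
  simp [reflect_apply, tilde_tilde]

variable (K) in
/-- The involution as a homeomorphism. -/
def tildeHomeomorph : K ≃ₜ K where
  toFun := tilde
  invFun := tilde
  left_inv := tilde_tilde
  right_inv := tilde_tilde
  continuous_toFun := continuous_tilde
  continuous_invFun := continuous_tilde

theorem hasCompactSupport_reflect {f : K →ᵇ ℂ} (hf : HasCompactSupport f) :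
    HasCompactSupport (reflect f) :=
  hf.comp_homeomorph (tildeHomeomorph K)

theorem exists_isCompact_support_subset {P : Set (K × K)} (hP : IsCompact P) :
    ∃ C : Set K, IsCompact C ∧ ∀ p ∈ P, (ω p.1 p.2).support ⊆ C := by
  refine hP.induction_on (p := fun P => ∃ C : Set K, IsCompact C ∧
    ∀ p ∈ P, (ω p.1 p.2).support ⊆ C) ⟨∅, isCompact_empty, by simp⟩ ?_ ?_ ?_
  · rintro s t hst ⟨C, hC, h⟩
    exact ⟨C, hC, fun p hp => h p (hst hp)⟩
  · rintro s t ⟨C, hC, h⟩ ⟨C', hC', h'⟩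
    refine ⟨C ∪ C', hC.union hC', fun p hp => ?_⟩
    rcases hp with hp | hp
    · exact (h p hp).trans Set.subset_union_left
    · exact (h' p hp).trans Set.subset_union_right
  · intro p _
    obtain ⟨C, hC, hpC⟩ := exists_compact_superset (isCompact_support_ω p.1 p.2)
    exact ⟨_, mem_nhdsWithin_of_mem_nhds ((isOpen_support_subset _ isOpen_interior).mem_nhds hpC),
      C, hC, fun q hq => Set.Subset.trans hq interior_subset⟩

/-- Separate `u` from the closed set `supp ω(p)` by a compact neighbourhood of `u`; the supports
avoiding it form an open condition in the Michael topology. -/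
theorem isClosed_mem_support :
    IsClosed {q : K × K × K | q.1 ∈ (ω q.2.1 q.2.2).support} := by
  rw [← isOpen_compl_iff, isOpen_iff_mem_nhds]
  rintro ⟨u, p⟩ hu
  have hu' : {u} ⊆ ((ω p.1 p.2).support)ᶜ := by simpa using hu
  obtain ⟨C, hC, -, huC, hCs⟩ := exists_compact_closed_between isCompact_singleton
    Measure.isClosed_support.isOpen_compl hu'
  have h1 : interior C ∈ 𝓝 u := isOpen_interior.mem_nhds (huC rfl)
  have h2 := (isOpen_support_subset (K := K) _ hC.isClosed.isOpen_compl).mem_nhds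
    (Set.subset_compl_comm.1 hCs : p ∈ _)
  filter_upwards [prod_mem_nhds h1 h2] with q hq hq'
  exact hq.2 hq' (interior_subset hq.1)

theorem exists_nhds_e_disjoint_support {P : Set (K × K)} (hP : IsCompact P)
    (h : ∀ p ∈ P, (e : K) ∉ (ω p.1 p.2).support) :
    ∃ U : Set K, IsOpen U ∧ (e : K) ∈ U ∧ ∀ p ∈ P, ∀ u ∈ U, u ∉ (ω p.1 p.2).support := by
  obtain ⟨U, V, hU, -, hsU, hPV, hUV⟩ := generalized_tube_lemma (isCompact_singleton (x := (e : K)))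
    hP (isClosed_mem_support (K := K)).isOpen_compl (by
      rintro ⟨u, p⟩ ⟨hu, hp⟩
      rw [Set.mem_singleton_iff] at hu
      simp only at hu hp
      subst hu
      exact h p hp)
  exact ⟨U, hU, hsU rfl, fun p hp u hu => hUV (Set.mk_mem_prod hu (hPV hp))⟩

/-- Otherwise `e` lies in no `supp ω(r, w)` with `r ∈ supp ω(ũ, t)`, and by compactness a bump `f`
at `e` vanishes on all of them. Associativity then gives `∫ T_ũ f dω(t, w) = 0`, although `T_ũ f ≥
0` is positive at `u` because `e ∈ supp ω(ũ, u)`. -/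
theorem tilde_mem_support {u t w : K} (hu : u ∈ (ω t w).support) :
    tilde w ∈ (ω (tilde u) t).support := by
  by_contra hw
  have hP : IsCompact ((ω (tilde u) t).support ×ˢ ({w} : Set K)) :=
    (isCompact_support_ω _ _).prod isCompact_singleton
  obtain ⟨U, hU, heU, hdis⟩ := exists_nhds_e_disjoint_support hP (by
    rintro ⟨r, w'⟩ ⟨hr, hw'⟩ he
    rw [Set.mem_singleton_iff] at hw'
    simp only at hr hw' he
    subst hw'
    rw [e_mem_support_iff] at he
    exact hw (he ▸ hr))
  obtain ⟨f, r, hrc, -, -, hfr, hr0, hr1, hre, hrU⟩ := exists_urysohn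
    (isCompact_singleton (x := (e : K))) hU (by simpa using heU)
  have hri : ∀ x y : K, Integrable r (ω x y) := fun x y =>
    Integrable.of_bound hrc.aestronglyMeasurable 1
      (.of_forall fun x => by rw [Real.norm_eq_abs, abs_of_nonneg (hr0 x)]; exact hr1 x)
  have key := assoc_ω (tilde u) t w f
  have hzero : ∫ s, (∫ a, f a ∂(ω s w)) ∂(ω (tilde u) t) = 0 := by
    rw [integral_ω_congr (g := fun _ => (0 : ℂ)), integral_zero]
    intro s hs
    rw [integral_ω_congr (g := fun _ => (0 : ℂ)), integral_zero]
    intro a ha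
    rw [hfr, hrU a fun haU => hdis (s, w) ⟨hs, rfl⟩ a haU ha, Complex.ofReal_zero]
  rw [hzero] at key
  have hT : ∀ s, ∫ a, f a ∂(ω (tilde u) s) = ((∫ a, r a ∂(ω (tilde u) s) : ℝ) : ℂ) :=
    fun s => T_ofReal hfr _ _
  simp_rw [hT] at key
  rw [integral_complex_ofReal, Complex.ofReal_eq_zero] at key
  have hcont : Continuous fun s => ∫ a, r a ∂(ω (tilde u) s) := by
    have := Complex.continuous_re.comp (T (tilde u) f).continuous
    refine this.congr fun s => ?_
    simp [T_ofReal hfr]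
  refine (integral_pos_of_mem_support hcont ?_ (fun s => integral_nonneg hr0) hu ?_).ne' key
  · refine Integrable.of_bound hcont.aestronglyMeasurable 1 (.of_forall fun s => ?_)
    rw [Real.norm_eq_abs, abs_of_nonneg (integral_nonneg hr0)]
    simpa using integral_mono (hri (tilde u) s) (integrable_const (1 : ℝ)) hr1
  · refine integral_pos_of_mem_support hrc (hri _ _) hr0 (a := e) ?_ ?_
    · rw [e_mem_support_iff]
    · rw [hre e rfl]; exact one_pos

/-- By `tilde_mem_support`, `ỹ` lies in `supp ω(ũ, x)`, and these supports stay in a compact set as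
`u` and `x` run through `B` and `A`. This is what makes translates of `C_c` functions compactly
supported. -/
theorem exists_isCompact_of_support_inter {A B : Set K} (hA : IsCompact A) (hB : IsCompact B) :
    ∃ C : Set K, IsCompact C ∧ ∀ x ∈ A, ∀ y, ∀ u ∈ B, u ∈ (ω x y).support → y ∈ C := by
  obtain ⟨C, hC, h⟩ := exists_isCompact_support_subset ((hB.image continuous_tilde).prod hA)
  refine ⟨tilde '' C, hC.image continuous_tilde, fun x hx y u hu hux => ?_⟩
  exact ⟨tilde y, h (tilde u, x) ⟨⟨u, hu, rfl⟩, hx⟩ (tilde_mem_support hux), tilde_tilde y⟩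

theorem exists_isCompact_T_eq_zero {A : Set K} (hA : IsCompact A) {f : K →ᵇ ℂ}
    (hf : HasCompactSupport f) :
    ∃ C : Set K, IsCompact C ∧ ∀ x ∈ A, ∀ y, y ∉ C → T x f y = 0 := by
  obtain ⟨C, hC, h⟩ := exists_isCompact_of_support_inter hA hf.isCompact
  refine ⟨C, hC, fun x hx y hy => ?_⟩
  rw [T_apply, integral_ω_congr (g := fun _ => (0 : ℂ)), integral_zero]
  intro t ht
  by_contra hne
  exact hy (h x hx y t (subset_tsupport _ hne) ht)

theorem hasCompactSupport_T (x : K) {f : K →ᵇ ℂ} (hf : HasCompactSupport f) :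
    HasCompactSupport (T x f) := by
  obtain ⟨C, hC, h⟩ := exists_isCompact_T_eq_zero (isCompact_singleton (x := x)) hf
  exact HasCompactSupport.intro hC fun y hy => h x rfl y hy

end Topology

/-! ### Haar measure: approximate identity, reflection and the adjoint of translation -/

section Haar

variable {K : Type*} [TopologicalSpace K] [T2Space K] [LocallyCompactSpace K]
  [MeasurableSpace K] [BorelSpace K] [Hypergroup K] {m : Measure K}

theorem IsHaarMeasure.integrable (hm : IsHaarMeasure m) {f : K →ᵇ ℂ} (hf : HasCompactSupport f) :
    Integrable f m :=
  have := hm.isFiniteMeasureOnCompacts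
  f.continuous.integrable_of_hasCompactSupport hf

theorem IsHaarMeasure.integral_T (hm : IsHaarMeasure m) (x : K) {f : K →ᵇ ℂ}
    (hf : HasCompactSupport f) : ∫ y, T x f y ∂m = ∫ y, f y ∂m :=
  hm.integral_translate x f f.continuous hf

theorem IsHaarMeasure.integral_T_ofReal (hm : IsHaarMeasure m) (x : K) {f : K →ᵇ ℂ} {r : K → ℝ}
    (hf : HasCompactSupport f) (hr : ∀ x, f x = r x) :
    ∫ y, (∫ t, r t ∂(ω x y)) ∂m = ∫ y, r y ∂m := by
  have := hm.integral_T x hf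
  simp_rw [T_ofReal hr, hr] at this
  rwa [integral_complex_ofReal, integral_complex_ofReal, Complex.ofReal_inj] at this

theorem continuous_integral_ofReal {f : K →ᵇ ℂ} {r : K → ℝ} (hr : ∀ x, f x = r x) (x : K) :
    Continuous fun y => ∫ t, r t ∂(ω x y) :=
  (Complex.continuous_re.comp (T x f).continuous).congr fun s => by simp [T_ofReal hr]

theorem IsHaarMeasure.integrable_integral_ofReal (hm : IsHaarMeasure m) {f : K →ᵇ ℂ} {r : K → ℝ}
    (hf : HasCompactSupport f) (hr : ∀ x, f x = r x) (x : K) :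
    Integrable (fun y => ∫ t, r t ∂(ω x y)) m :=
  (hm.integrable (hasCompactSupport_T x hf)).re.congr (.of_forall fun s => by simp [T_ofReal hr])

theorem IsHaarMeasure.nonempty_support (hm : IsHaarMeasure m) : m.support.Nonempty := by
  have := hm.innerRegular
  by_contra h
  rw [Set.not_nonempty_iff_eq_empty] at h
  have := Measure.measure_compl_support_of_innerRegular (μ := m)
  rw [h, Set.compl_empty, Measure.measure_univ_eq_zero] at this
  exact hm.ne_zero this

/-- For `a` in the support of `m`, invariance replaces `r` by `T_ã r`, which is positive at `a`
since `e ∈ supp ω(ã, a)`. -/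
theorem IsHaarMeasure.integral_pos (hm : IsHaarMeasure m) {f : K →ᵇ ℂ} {r : K → ℝ}
    (hf : HasCompactSupport f) (hr : ∀ x, f x = r x) (hrc : Continuous r)
    (h0 : ∀ x, 0 ≤ r x) (he : 0 < r e) : 0 < ∫ x, r x ∂m := by
  obtain ⟨a, ha⟩ := hm.nonempty_support
  rw [← hm.integral_T_ofReal (tilde a) hf hr]
  refine integral_pos_of_mem_support (continuous_integral_ofReal hr _)
    (hm.integrable_integral_ofReal hf hr _) (fun y => integral_nonneg h0) ha ?_
  refine integral_pos_of_mem_support hrc ?_ h0 (a := e) (by rw [e_mem_support_iff]) he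
  exact (f.integrable _).re.congr (.of_forall fun s => by simp [hr])

/-- A nonnegative bump function with integral one, supported in a given neighbourhood of `e`. -/
structure IsBump (m : Measure K) (U : Set K) (h : K →ᵇ ℂ) : Prop where
  hasCompactSupport : HasCompactSupport h
  nonneg : ∃ r : K → ℝ, (∀ x, h x = r x) ∧ ∀ x, 0 ≤ r x
  eq_zero : ∀ x, x ∉ U → h x = 0
  integral_eq_one : ∫ x, h x ∂m = 1

theorem IsHaarMeasure.exists_isBump (hm : IsHaarMeasure m) {U : Set K} (hU : IsOpen U)
    (he : e ∈ U) : ∃ h : K →ᵇ ℂ, IsBump m U h := by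
  obtain ⟨f, r, hrc, -, hf, hfr, hr0, -, hre, hrU⟩ := exists_urysohn
    (isCompact_singleton (x := (e : K))) hU (by simpa using he)
  have hpos := hm.integral_pos hf hfr hrc hr0 (by rw [hre e rfl]; exact one_pos)
  set c := ∫ x, r x ∂m with hc
  refine ⟨((c⁻¹ : ℝ) : ℂ) • f, ?_, ⟨fun x => c⁻¹ * r x, fun x => by simp [hfr], fun x =>
    mul_nonneg (inv_nonneg.2 hpos.le) (hr0 x)⟩, fun x hx => by simp [hfr, hrU x hx], ?_⟩
  · exact hf.smul_left (f := fun _ => ((c⁻¹ : ℝ) : ℂ))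
  · simp only [BoundedContinuousFunction.coe_smul, smul_eq_mul, hfr]
    rw [integral_const_mul, integral_complex_ofReal, ← hc, ← Complex.ofReal_mul,
      inv_mul_cancel₀ hpos.ne', Complex.ofReal_one]

/-- Pairs with `‖f(z̃) - f(t)‖ ≥ ε` have `t ≠ z̃`, so `e ∉ supp ω(t, z)`. Keeping `U` inside a
compact set confines `z` to a compact set, and a single `U` then excludes all bad pairs. -/
theorem exists_nhds_norm_sub_le (f : K →ᵇ ℂ) {C : Set K} (hC : IsCompact C) {ε : ℝ} (hε : 0 < ε) :
    ∃ U : Set K, IsOpen U ∧ e ∈ U ∧ ∀ t ∈ C, ∀ z, ∀ u ∈ U, u ∈ (ω t z).support →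
      ‖f (tilde z) - f t‖ ≤ ε := by
  obtain ⟨U₀, hU₀, heU₀⟩ := exists_compact_mem_nhds (e : K)
  obtain ⟨C', hC', h'⟩ := exists_isCompact_of_support_inter hC hU₀
  have hcont : Continuous fun p : K × K => ‖f (tilde p.2) - f p.1‖ :=
    ((f.continuous.comp (continuous_tilde.comp continuous_snd)).sub
      (f.continuous.comp continuous_fst)).norm
  have hP : IsCompact ((C ×ˢ C') ∩ {p : K × K | ε ≤ ‖f (tilde p.2) - f p.1‖}) :=
    (hC.prod hC').inter_right (isClosed_le continuous_const hcont)
  obtain ⟨U, hU, heU, hdis⟩ := exists_nhds_e_disjoint_support hP (by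
    rintro ⟨t, z⟩ ⟨-, hp⟩ he
    rw [e_mem_support_iff] at he
    simp only at he
    simp [he] at hp
    linarith)
  refine ⟨U ∩ interior U₀, hU.inter isOpen_interior,
    ⟨heU, mem_interior_iff_mem_nhds.2 heU₀⟩, fun t ht z u hu hut => ?_⟩
  by_contra! hlt
  exact hdis (t, z) ⟨⟨ht, h' t ht z u (interior_subset hu.2) hut⟩, hlt.le⟩ u hu.1 hut

/-- `T_t h` has integral one and lives where `supp ω(t, z)` meets `U`, that is, where `f(z̃)` is
within `ε` of `f(t)`: an approximate identity concentrated near `z = t̃`. -/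
theorem IsHaarMeasure.norm_integral_mul_T_sub_le (hm : IsHaarMeasure m) {f h : K →ᵇ ℂ}
    (hf : HasCompactSupport f) {U : Set K} (hh : IsBump m U h) {ε : ℝ} {t : K}
    (hU : ∀ z, ∀ u ∈ U, u ∈ (ω t z).support → ‖f (tilde z) - f t‖ ≤ ε) :
    ‖(∫ z, reflect f z * T t h z ∂m) - f t‖ ≤ ε := by
  obtain ⟨r, hr, hr0⟩ := hh.nonneg
  have hTh := hasCompactSupport_T t hh.hasCompactSupport
  have h1 : ∫ z, T t h z ∂m = 1 := by rw [hm.integral_T t hh.hasCompactSupport, hh.integral_eq_one]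
  have h2 : ∫ y, (∫ s, r s ∂(ω t y)) ∂m = 1 := by
    have := h1
    simp_rw [T_ofReal hr] at this
    rw [integral_complex_ofReal] at this
    exact_mod_cast this
  have i1 : Integrable (fun z => reflect f z * T t h z) m :=
    hm.integrable (f := reflect f * T t h) ((hasCompactSupport_reflect hf).mul_right)
  have i2 : Integrable (fun z => f t * T t h z) m := (hm.integrable hTh).const_mul _
  have h3 : (∫ z, reflect f z * T t h z ∂m) - f t = ∫ z, (reflect f z - f t) * T t h z ∂m := by
    simp_rw [sub_mul]
    rw [integral_sub i1 i2, integral_const_mul, h1, mul_one]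
  rw [h3]
  calc _ ≤ ∫ z, ε * ∫ s, r s ∂(ω t z) ∂m := by
        refine norm_integral_le_of_norm_le
          ((hm.integrable_integral_ofReal hh.hasCompactSupport hr t).const_mul ε)
          (.of_forall fun z => ?_)
        have hn : ‖T t h z‖ = ∫ s, r s ∂(ω t z) := by
          rw [T_ofReal hr, Complex.norm_real, Real.norm_eq_abs, abs_of_nonneg (integral_nonneg hr0)]
        rw [norm_mul, hn]
        by_cases hz : ∃ u ∈ U, u ∈ (ω t z).support
        · obtain ⟨u, hu, hut⟩ := hz
          exact mul_le_mul_of_nonneg_right (hU z u hu hut) (integral_nonneg hr0)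
        · have : T t h z = 0 := by
            rw [T_apply, integral_ω_congr (g := fun _ => (0 : ℂ)), integral_zero]
            exact fun s hs => hh.eq_zero s fun hsU => hz ⟨s, hsU, hs⟩
          rw [← hn, this, norm_zero, mul_zero, mul_zero]
    _ = ε := by rw [integral_const_mul, h2, mul_one]

/-- Fubini's theorem for the product of a Haar measure and `ω x y`. -/
theorem IsHaarMeasure.integral_mul_T_T (hm : IsHaarMeasure m) {f : K →ᵇ ℂ}
    (hf : HasCompactSupport f) (h : K →ᵇ ℂ) (x y : K) :
    ∫ z, f z * T y (T x h) z ∂m = ∫ t, (∫ z, f z * T t h z ∂m) ∂(ω x y) := by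
  have := hm.isFiniteMeasureOnCompacts
  -- The cutoff `χ`, equal to one on `supp ω(x, y)`, makes the integrand compactly supported in both
  -- variables, so the swap needs no σ-finiteness of `m`.
  obtain ⟨χ, r, -, -, hχ, hχr, -, -, hr1, -⟩ := exists_urysohn (isCompact_support_ω x y)
    isOpen_univ (Set.subset_univ _)
  have hχ1 : ∀ t ∈ (ω x y).support, χ t = 1 := fun t ht => by rw [hχr, hr1 t ht, Complex.ofReal_one]
  have hswap := integral_integral_swap_of_hasCompactSupport (μ := m) (ν := ω x y)
    (f := fun z t => χ t * (f z * T t h z)) ?_ ?_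
  · calc _ = ∫ z, ∫ t, χ t * (f z * T t h z) ∂(ω x y) ∂m := by
          congr 1; ext z
          rw [T_T_apply, ← integral_const_mul]
          exact integral_ω_congr fun t ht => by rw [hχ1 t ht, one_mul]
      _ = _ := by
          rw [hswap]
          refine integral_ω_congr fun t ht => ?_
          rw [integral_const_mul, hχ1 t ht, one_mul]
  · exact (χ.continuous.comp continuous_snd).mul ((f.continuous.comp continuous_fst).mul
      ((continuous_T h).comp continuous_swap))
  · refine HasCompactSupport.intro (hf.isCompact.prod hχ.isCompact) fun p hp => ?_
    rw [Set.mem_prod, not_and_or] at hp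
    rcases hp with hp | hp
    · simp [Function.uncurry, image_eq_zero_of_notMem_tsupport hp]
    · simp [Function.uncurry, image_eq_zero_of_notMem_tsupport hp]

theorem IsHaarMeasure.continuous_integral_mul_T (hm : IsHaarMeasure m) {f : K →ᵇ ℂ}
    (hf : HasCompactSupport f) (h : K →ᵇ ℂ) : Continuous fun y => ∫ z, f z * T y h z ∂m := by
  have := hm.isFiniteMeasureOnCompacts
  rw [← continuousOn_univ]
  refine continuousOn_integral_of_compact_support hf.isCompact ?_ fun p z _ hz => ?_
  · exact ((f.continuous.comp continuous_snd).mul (continuous_T h)).continuousOn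
  · rw [image_eq_zero_of_notMem_tsupport hz, zero_mul]

theorem IsHaarMeasure.norm_integral_mul_sub_le (hm : IsHaarMeasure m) {f g h : K →ᵇ ℂ}
    (hf : HasCompactSupport f) (hg : HasCompactSupport g) (x : K) {U : Set K} (hh : IsBump m U h)
    {ε : ℝ} (hU : ∀ y ∈ tsupport g, ∀ t ∈ (ω x y).support, ∀ z, ∀ u ∈ U, u ∈ (ω t z).support →
      ‖f (tilde z) - f t‖ ≤ ε) :
    ‖(∫ y, g y * (∫ z, reflect f z * T y (T x h) z ∂m) ∂m) - ∫ y, T x f y * g y ∂m‖ ≤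
      ε * ∫ y, ‖g y‖ ∂m := by
  have := hm.isFiniteMeasureOnCompacts
  have hf' := hasCompactSupport_reflect hf
  have i1 : Integrable (fun y => g y * (∫ z, reflect f z * T y (T x h) z ∂m)) m :=
    (g.continuous.mul (hm.continuous_integral_mul_T hf' _)).integrable_of_hasCompactSupport
      hg.mul_right
  have i2 : Integrable (fun y => T x f y * g y) m :=
    hm.integrable (f := T x f * g) hg.mul_left
  rw [← integral_sub i1 i2, ← integral_const_mul]
  refine norm_integral_le_of_norm_le ((hm.integrable hg).norm.const_mul ε) (.of_forall fun y => ?_)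
  by_cases hy : y ∈ tsupport g
  · rw [mul_comm (T x f y), ← mul_sub, norm_mul, mul_comm]
    refine mul_le_mul_of_nonneg_right ?_ (norm_nonneg _)
    have hc := hm.continuous_integral_mul_T hf' h
    -- The inner integral is known to be continuous in `t`, and no bound is at hand; cutting it off
    -- outside `supp ω(x, y)` gives integrability.
    obtain ⟨χ, r, -, -, hχ, hχr, -, -, hr1, -⟩ := exists_urysohn (isCompact_support_ω x y)
      isOpen_univ (Set.subset_univ _)
    have hi : Integrable (fun t => ∫ z, reflect f z * T t h z ∂m) (ω x y) := by
      have : Integrable (fun t => χ t * ∫ z, reflect f z * T t h z ∂m) (ω x y) :=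
        (χ.continuous.mul hc).integrable_of_hasCompactSupport hχ.mul_right
      refine this.congr ((ae_mem_support x y).mono fun t ht => ?_)
      simp [hχr, hr1 t ht]
    rw [hm.integral_mul_T_T hf', T_apply, ← integral_sub hi (integrable_ω f x y)]
    exact norm_integral_ω_le fun t ht => hm.norm_integral_mul_T_sub_le hf hh (hU y hy t ht)
  · simp [image_eq_zero_of_notMem_tsupport hy]

/-- For a bump `h` near `e`, the double integral of `g(y) f(z̃) (T_y T_x h)(z)` approximates the
left side when `z` is integrated first and the right side when `y` is, because `T_y k(z) = T_z
k(y)`. -/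
theorem IsHaarMeasure.integral_T_mul_eq_reflect (hm : IsHaarMeasure m) (hK : IsCommutative K)
    {f g : K →ᵇ ℂ} (hf : HasCompactSupport f) (hg : HasCompactSupport g) (x : K) :
    ∫ y, T x f y * g y ∂m = ∫ z, T x (reflect g) z * reflect f z ∂m := by
  have := hm.isFiniteMeasureOnCompacts
  have hf' := hasCompactSupport_reflect hf
  have hg' := hasCompactSupport_reflect hg
  set A := ∫ y, ‖g y‖ ∂m
  set B := ∫ y, ‖reflect f y‖ ∂m
  have hA : 0 ≤ A := integral_nonneg fun _ => norm_nonneg _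
  have hB : 0 ≤ B := integral_nonneg fun _ => norm_nonneg _
  rw [← sub_eq_zero, ← norm_le_zero_iff]
  refine le_of_forall_pos_le_add fun δ hδ => ?_
  set ε := δ / (A + B + 1) with hεd
  have hε : 0 < ε := by positivity
  obtain ⟨C₁, hC₁, h₁⟩ := exists_isCompact_support_subset
    ((isCompact_singleton (x := x)).prod hg.isCompact)
  obtain ⟨C₂, hC₂, h₂⟩ := exists_isCompact_support_subset
    ((isCompact_singleton (x := x)).prod hf'.isCompact)
  obtain ⟨U₁, hU₁, he₁, hfU⟩ := exists_nhds_norm_sub_le f hC₁ hε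
  obtain ⟨U₂, hU₂, he₂, hgU⟩ := exists_nhds_norm_sub_le (reflect g) hC₂ hε
  obtain ⟨h, hh⟩ := hm.exists_isBump (hU₁.inter hU₂) ⟨he₁, he₂⟩
  have e₁ := hm.norm_integral_mul_sub_le hf hg x hh (ε := ε) fun y hy t ht z u hu hut =>
    hfU t (h₁ (x, y) ⟨rfl, hy⟩ ht) z u hu.1 hut
  have e₂ := hm.norm_integral_mul_sub_le hg' hf' x hh (ε := ε) fun y hy t ht z u hu hut =>
    hgU t (h₂ (x, y) ⟨rfl, hy⟩ ht) z u hu.2 hut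
  have hswap : ∫ y, g y * (∫ z, reflect f z * T y (T x h) z ∂m) ∂m =
      ∫ y, reflect f y * (∫ z, reflect (reflect g) z * T y (T x h) z ∂m) ∂m := by
    simp_rw [reflect_reflect, ← integral_const_mul]
    rw [integral_integral_swap_of_hasCompactSupport]
    · congr 1; ext z; congr 1; ext y
      rw [T_comm hK]; ring
    · exact (g.continuous.comp continuous_fst).mul
        (((reflect f).continuous.comp continuous_snd).mul (continuous_T (T x h)))
    · refine HasCompactSupport.intro (hg.isCompact.prod hf'.isCompact) fun p hp => ?_
      rw [Set.mem_prod, not_and_or] at hp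
      rcases hp with hp | hp
      · simp [Function.uncurry, image_eq_zero_of_notMem_tsupport hp]
      · simp [Function.uncurry, image_eq_zero_of_notMem_tsupport hp]
  rw [hswap] at e₁
  have : ε * A + ε * B ≤ δ := by
    have : ε * (A + B + 1) = δ := div_mul_cancel₀ _ (by positivity)
    nlinarith
  rw [zero_add]
  refine le_trans ?_ this
  rw [norm_sub_rev] at e₁
  refine le_trans ?_ (add_le_add e₁ e₂)
  refine le_trans (le_of_eq ?_) (norm_add_le _ _)
  congr 1
  ring

/-- The case `x = e` of the preceding identity, with `g` a cutoff equal to one on the support of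
`f`. -/
theorem IsHaarMeasure.integral_reflect (hm : IsHaarMeasure m) (hK : IsCommutative K)
    {f : K →ᵇ ℂ} (hf : HasCompactSupport f) : ∫ x, reflect f x ∂m = ∫ x, f x ∂m := by
  obtain ⟨χ, r, -, -, hχ, hχr, -, -, hr1, -⟩ := exists_urysohn hf.isCompact isOpen_univ
    (Set.subset_univ _)
  have hmul : ∀ x, f x * χ x = f x := fun x => by
    by_cases hx : x ∈ tsupport f
    · rw [hχr, hr1 x hx, Complex.ofReal_one, mul_one]
    · rw [image_eq_zero_of_notMem_tsupport hx, zero_mul]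
  have := hm.integral_T_mul_eq_reflect hK hf hχ e
  simp_rw [T_e, hmul] at this
  rw [this]
  congr 1; ext x
  rw [reflect_apply, reflect_apply, mul_comm, hmul]

theorem IsHaarMeasure.integral_T_mul (hm : IsHaarMeasure m) (hK : IsCommutative K)
    {f : K →ᵇ ℂ} (hf : HasCompactSupport f) (g : K →ᵇ ℂ) (x : K) :
    ∫ y, T x f y * g y ∂m = ∫ y, f y * T (tilde x) g y ∂m := by
  obtain ⟨C, hC, hCs⟩ := exists_isCompact_support_subset
    ((isCompact_singleton (x := tilde x)).prod hf.isCompact)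
  -- `g` need not have compact support, but both sides see it only on the support of `T_x f` and on
  -- `supp ω(x̃, y)` for `y` in the support of `f`.
  obtain ⟨χ, r, -, -, hχ, hχr, -, -, hr1, -⟩ := exists_urysohn
    ((hasCompactSupport_T x hf).isCompact.union hC) isOpen_univ (Set.subset_univ _)
  have hχ1 : ∀ t ∈ tsupport (T x f) ∪ C, χ t = 1 := fun t ht => by
    rw [hχr, hr1 t ht, Complex.ofReal_one]
  have hgχ : HasCompactSupport (g * χ) := hχ.mul_left
  calc ∫ y, T x f y * g y ∂m = ∫ y, T x f y * (g * χ) y ∂m := by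
        congr 1; ext y
        by_cases hy : y ∈ tsupport (T x f)
        · simp [hχ1 y (.inl hy)]
        · simp [image_eq_zero_of_notMem_tsupport hy]
    _ = ∫ y, reflect (f * T (tilde x) (g * χ)) y ∂m := by
        rw [hm.integral_T_mul_eq_reflect hK hf hgχ]
        congr 1; ext y
        rw [← reflect_reflect (T x _), reflect_T hK, reflect_reflect, reflect_apply, reflect_apply,
          reflect_apply, mul_comm]
        rfl
    _ = ∫ y, (f * T (tilde x) (g * χ)) y ∂m := hm.integral_reflect hK hf.mul_right
    _ = _ := by
        congr 1; ext y
        by_cases hy : y ∈ tsupport f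
        · rw [BoundedContinuousFunction.mul_apply, T_apply, T_apply]
          congr 1
          exact integral_ω_congr fun t ht => by simp [hχ1 t (.inr (hCs (tilde x, y) ⟨rfl, hy⟩ ht))]
        · simp [image_eq_zero_of_notMem_tsupport hy]

end Haar

/-! ### Null sets under translation and reflection -/

section NullSets

variable {K : Type*} [TopologicalSpace K]

/-- A continuous function with values in `[0, 1]` and compact support, vanishing outside `U`. -/
structure IsCutoff (U : Set K) (r : K → ℝ) : Prop where
  continuous : Continuous r
  hasCompactSupport : HasCompactSupport r
  nonneg : ∀ x, 0 ≤ r x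
  le_one : ∀ x, r x ≤ 1
  eq_zero : ∀ x, x ∉ U → r x = 0

namespace IsCutoff

variable {U : Set K} {r s : K → ℝ}

theorem sup [R1Space K] (hr : IsCutoff U r) (hs : IsCutoff U s) : IsCutoff U fun x => max (r x) (s x) where
  continuous := hr.continuous.max hs.continuous
  hasCompactSupport := by
    refine HasCompactSupport.intro (hr.hasCompactSupport.isCompact.union
      hs.hasCompactSupport.isCompact) fun x hx => ?_
    rw [Set.mem_union, not_or] at hx
    simp [image_eq_zero_of_notMem_tsupport hx.1, image_eq_zero_of_notMem_tsupport hx.2]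
  nonneg x := (hr.nonneg x).trans (le_max_left _ _)
  le_one x := max_le (hr.le_one x) (hs.le_one x)
  eq_zero x hx := by simp [hr.eq_zero x hx, hs.eq_zero x hx]

theorem exists_boundedContinuous (hr : IsCutoff U r) :
    ∃ f : K →ᵇ ℂ, HasCompactSupport f ∧ ∀ x, f x = r x := by
  have hc : HasCompactSupport fun x => (r x : ℂ) :=
    hr.hasCompactSupport.comp_left (g := ((↑) : ℝ → ℂ)) Complex.ofReal_zero
  obtain ⟨f, hf⟩ := exists_boundedContinuous_eq (Complex.continuous_ofReal.comp hr.continuous) hc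
  exact ⟨f, by rw [hf]; exact hc, fun x => by rw [hf]; rfl⟩

variable [MeasurableSpace K] [BorelSpace K] {μ : Measure K}
  [IsFiniteMeasureOnCompacts μ]

theorem integrable (hr : IsCutoff U r) : Integrable r μ :=
  hr.continuous.integrable_of_hasCompactSupport hr.hasCompactSupport

theorem measure_le_ofReal_integral (hr : IsCutoff U r) {L : Set K} (hL : MeasurableSet L)
    (h : ∀ x ∈ L, r x = 1) : μ L ≤ ENNReal.ofReal (∫ x, r x ∂μ) := by
  rw [ofReal_integral_eq_lintegral_ofReal hr.integrable (.of_forall hr.nonneg),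
    ← lintegral_indicator_one hL]
  refine lintegral_mono fun x => ?_
  by_cases hx : x ∈ L <;> simp [hx, h]

theorem ofReal_integral_le_measure (hr : IsCutoff U r) (hU : MeasurableSet U) :
    ENNReal.ofReal (∫ x, r x ∂μ) ≤ μ U := by
  rw [ofReal_integral_eq_lintegral_ofReal hr.integrable (.of_forall hr.nonneg),
    ← lintegral_indicator_one hU]
  refine lintegral_mono fun x => ?_
  by_cases hx : x ∈ U
  · simp [hx, hr.le_one]
  · simp [hx, hr.eq_zero]

end IsCutoff

theorem exists_isCutoff [T2Space K] [LocallyCompactSpace K] {L U : Set K} (hL : IsCompact L)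
    (hU : IsOpen U) (hLU : L ⊆ U) : ∃ r : K → ℝ, IsCutoff U r ∧ ∀ x ∈ L, r x = 1 := by
  obtain ⟨-, r, hr, hc, -, -, h0, h1, hr1, hrU⟩ := exists_urysohn hL hU hLU
  exact ⟨r, ⟨hr, hc, h0, h1, hrU⟩, hr1⟩

variable [T2Space K] [LocallyCompactSpace K] [MeasurableSpace K] [BorelSpace K] [Hypergroup K]
  {m : Measure K}

theorem IsCutoff.continuous_integral_ω {U : Set K} {r : K → ℝ} (hr : IsCutoff U r) (x : K) :
    Continuous fun y => ∫ t, r t ∂(ω x y) := by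
  obtain ⟨f, -, hf⟩ := hr.exists_boundedContinuous
  exact continuous_integral_ofReal hf x

theorem exists_isCutoff_lt_integral {U : Set K} (hU : IsOpen U) {c : ℝ≥0∞} {x y : K}
    (h : c < ω x y U) : ∃ r, IsCutoff U r ∧ c < ENNReal.ofReal (∫ t, r t ∂(ω x y)) := by
  obtain ⟨L, hLU, hL, hcL⟩ := hU.exists_lt_isCompact h
  obtain ⟨r, hr, hr1⟩ := exists_isCutoff hL hU hLU
  exact ⟨r, hr, hcL.trans_le (hr.measure_le_ofReal_integral hL.measurableSet hr1)⟩

theorem exists_isCutoff_forall_lt_integral {U C : Set K} (hU : IsOpen U) (hC : IsCompact C)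
    {c : ℝ≥0∞} {x : K} (h : ∀ y ∈ C, c < ω x y U) :
    ∃ r, IsCutoff U r ∧ ∀ y ∈ C, c < ENNReal.ofReal (∫ t, r t ∂(ω x y)) := by
  refine hC.induction_on (p := fun s => ∃ r, IsCutoff U r ∧
    ∀ y ∈ s, c < ENNReal.ofReal (∫ t, r t ∂(ω x y))) ?_ ?_ ?_ ?_
  · exact ⟨fun _ => 0, ⟨continuous_const, HasCompactSupport.zero, fun _ => le_rfl,
      fun _ => zero_le_one, fun _ _ => rfl⟩, by simp⟩
  · rintro s t hst ⟨r, hr, h⟩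
    exact ⟨r, hr, fun y hy => h y (hst hy)⟩
  · rintro s t ⟨r, hr, h⟩ ⟨r', hr', h'⟩
    -- Cutoffs for `U` are directed under `max`, so the local choices around points of `C` combine
    -- into one.
    refine ⟨_, hr.sup hr', fun y hy => ?_⟩
    rcases hy with hy | hy
    · exact (h y hy).trans_le (ENNReal.ofReal_le_ofReal
        (integral_mono hr.integrable (hr.sup hr').integrable fun t => le_max_left _ _))
    · exact (h' y hy).trans_le (ENNReal.ofReal_le_ofReal
        (integral_mono hr'.integrable (hr.sup hr').integrable fun t => le_max_right _ _))
  · intro y hy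
    obtain ⟨r, hr, hc⟩ := exists_isCutoff_lt_integral hU (h y hy)
    refine ⟨_, mem_nhdsWithin_of_mem_nhds ?_, r, hr, fun y hy => hy⟩
    exact (isOpen_lt continuous_const (ENNReal.continuous_ofReal.comp
      (hr.continuous_integral_ω x))).mem_nhds hc

/-- For open `U`, `y ↦ ω(x, y)(U)` is lower semicontinuous, being a supremum of integrals of
cutoffs; open sets form a generating π-system. -/
theorem measurable_ω (x : K) : Measurable (ω x) := by
  refine Measurable.measure_of_isPiSystem_of_isProbabilityMeasure (S := {s | IsOpen s})
    BorelSpace.measurable_eq isPiSystem_isOpen fun U hU => measurable_of_Ioi fun c => ?_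
  refine IsOpen.measurableSet (isOpen_iff_mem_nhds.2 fun y hy => ?_)
  obtain ⟨r, hr, hc⟩ := exists_isCutoff_lt_integral hU hy
  filter_upwards [(isOpen_lt continuous_const (ENNReal.continuous_ofReal.comp
    (hr.continuous_integral_ω x))).mem_nhds hc] with z hz
  exact lt_of_lt_of_le hz (hr.ofReal_integral_le_measure (IsOpen.measurableSet hU))

/-- If `ω(x, y)(N) > c` on a compact set `C` of positive measure, a cutoff `r` in a small open set
around the relevant part of `N` still has `T_x r > c` on `C`, so `∫ T_x r dm ≥ c m(C)` exceeds `∫ r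
dm`. -/
theorem IsHaarMeasure.ae_ω_eq_zero (hm : IsHaarMeasure m) {N : Set K} (hN : m N = 0) (x : K) :
    ∀ᵐ y ∂m, ω x y N = 0 := by
  have := hm.isFiniteMeasureOnCompacts
  have := hm.innerRegular
  wlog hNm : MeasurableSet N generalizing N
  · filter_upwards [this (N := toMeasurable m N) (by rwa [measure_toMeasurable])
      (measurableSet_toMeasurable _ _)] with y hy
    exact measure_mono_null (subset_toMeasurable _ _) hy
  have hmeas : Measurable fun y => ω x y N := (Measure.measurable_coe hNm).comp (measurable_ω x)
  have key : ∀ c : ℝ≥0∞, c ≠ 0 → c ≠ ∞ → m {y | c < ω x y N} = 0 := by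
    intro c hc0 hct
    by_contra hne
    obtain ⟨C, hCB, hC, hmC⟩ := (measurableSet_lt measurable_const hmeas).exists_lt_isCompact
      (pos_iff_ne_zero.2 hne)
    obtain ⟨C', hC', hs⟩ := exists_isCompact_support_subset
      ((isCompact_singleton (x := x)).prod hC)
    -- An inner regular `m` need not be outer regular at `N`; its restriction to an open `V` of
    -- finite measure is, and `V` contains every `supp ω(x, y)` with `y ∈ C`.
    obtain ⟨V, hCV, hV, hmV⟩ := hC'.exists_open_superset_measure_lt_top m
    have : Fact (m V < ∞) := ⟨hmV⟩
    obtain ⟨U, hNU, hU, hmU⟩ := Set.exists_isOpen_lt_of_lt (μ := m.restrict V) N (c * m C) (by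
      rw [Measure.restrict_apply hNm, measure_mono_null Set.inter_subset_left hN]
      exact ENNReal.mul_pos hc0 hmC.ne')
    rw [Measure.restrict_apply hU.measurableSet] at hmU
    have hUV := hU.inter hV
    obtain ⟨r, hr, hlt⟩ := exists_isCutoff_forall_lt_integral hUV hC (c := c) (x := x) (by
      intro y hy
      refine lt_of_lt_of_le (hCB hy) (measure_mono_ae ?_)
      filter_upwards [ae_mem_support x y] with t ht htN
      exact ⟨hNU htN, hCV (hs (x, y) ⟨rfl, hy⟩ ht)⟩)
    obtain ⟨f, hf, hfr⟩ := hr.exists_boundedContinuous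
    refine (lt_irrefl (c * m C) ?_)
    calc c * m C = ∫⁻ y in C, c ∂m := by rw [setLIntegral_const]
      _ ≤ ∫⁻ y in C, ENNReal.ofReal (∫ t, r t ∂(ω x y)) ∂m :=
          setLIntegral_mono' hC.measurableSet fun y hy => (hlt y hy).le
      _ ≤ ∫⁻ y, ENNReal.ofReal (∫ t, r t ∂(ω x y)) ∂m := setLIntegral_le_lintegral _ _
      _ = ENNReal.ofReal (∫ y, r y ∂m) := by
          rw [← hm.integral_T_ofReal x hf hfr, ofReal_integral_eq_lintegral_ofReal
            (hm.integrable_integral_ofReal hf hfr x) (.of_forall fun y => integral_nonneg hr.nonneg)]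
      _ ≤ m (U ∩ V) := hr.ofReal_integral_le_measure hUV.measurableSet
      _ < c * m C := hmU
  have h2 : ∀ᵐ y ∂m, ∀ n : ℕ, ¬ ((n : ℝ≥0∞) + 1)⁻¹ < ω x y N := by
    rw [ae_all_iff]
    intro n
    rw [ae_iff]
    simpa only [not_not] using key ((n : ℝ≥0∞) + 1)⁻¹ (by simp) (by simp)
  filter_upwards [h2] with y hy
  by_contra hne
  obtain ⟨n, hn⟩ := ENNReal.exists_inv_nat_lt hne
  exact hy n (lt_of_le_of_lt (ENNReal.inv_le_inv.2 le_self_add) hn)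

/-- Invariance under reflection is known for `C_c` functions only. A compact `L` of positive measure
in the preimage has a null compact image, whose small open neighbourhoods contradict that
invariance. -/
theorem IsHaarMeasure.measure_preimage_tilde (hm : IsHaarMeasure m) (hK : IsCommutative K)
    {N : Set K} (hN : m N = 0) : m (tilde ⁻¹' N) = 0 := by
  have := hm.isFiniteMeasureOnCompacts
  have := hm.innerRegular
  wlog hNm : MeasurableSet N generalizing N
  · exact measure_mono_null (Set.preimage_mono (subset_toMeasurable _ _))
      (this (N := toMeasurable m N) (by rwa [measure_toMeasurable])
      (measurableSet_toMeasurable _ _))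
  by_contra hne
  obtain ⟨L, hLN, hL, hmL⟩ := (continuous_tilde.measurable hNm).exists_lt_isCompact
    (pos_iff_ne_zero.2 hne)
  have hL' : IsCompact (tilde '' L) := hL.image continuous_tilde
  obtain ⟨U, hLU, hU, hmU⟩ := hL'.exists_isOpen_lt_of_lt (μ := m) (m L) (by
    rwa [measure_mono_null (Set.image_subset_iff.2 hLN) hN])
  obtain ⟨r, hr, hr1⟩ := exists_isCutoff hL' hU hLU
  obtain ⟨f, hf, hfr⟩ := hr.exists_boundedContinuous
  have hr' : IsCutoff (tilde ⁻¹' U) (r ∘ tilde) :=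
    ⟨hr.continuous.comp continuous_tilde, hr.hasCompactSupport.comp_homeomorph (tildeHomeomorph K),
      fun x => hr.nonneg _, fun x => hr.le_one _, fun x hx => hr.eq_zero _ hx⟩
  have hint : ∫ x, (r ∘ tilde) x ∂m = ∫ x, r x ∂m := by
    have := hm.integral_reflect hK hf
    simp_rw [reflect_apply, hfr] at this
    rwa [integral_complex_ofReal, integral_complex_ofReal, Complex.ofReal_inj] at this
  have h1 := hr'.measure_le_ofReal_integral (μ := m) hL.measurableSet
    fun x hx => hr1 _ ⟨x, hx, rfl⟩
  rw [hint] at h1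
  exact (h1.trans (hr.ofReal_integral_le_measure hU.measurableSet)).not_gt hmU

theorem IsHaarMeasure.translate_ae_eq (hm : IsHaarMeasure m) {f g : K → ℂ} (h : f =ᵐ[m] g) (x : K) :
    translate x f =ᵐ[m] translate x g := by
  filter_upwards [hm.ae_ω_eq_zero (ae_iff.1 h) x] with y hy
  exact integral_congr_ae (ae_iff.2 hy)

/-- By commutativity the value is `T_x f` at `ỹ`, so the exceptional set is the reflection of a null
set. -/
theorem IsHaarMeasure.translate_tilde_ae_eq (hm : IsHaarMeasure m) (hK : IsCommutative K)
    {f g : K → ℂ} (h : f =ᵐ[m] g) (x : K) :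
    ∀ᵐ y ∂m, translate (tilde y) f x = translate (tilde y) g x := by
  have h1 := hm.measure_preimage_tilde hK (ae_iff.1 (hm.translate_ae_eq h x))
  refine measure_mono_null (fun y hy => ?_) h1
  simpa [translate, hK x] using hy

theorem IsHaarMeasure.convolution_congr (hm : IsHaarMeasure m) (hK : IsCommutative K)
    {f f' g g' : K → ℂ} (hf : f =ᵐ[m] f') (hg : g =ᵐ[m] g') :
    convolution m f g = convolution m f' g' := by
  ext x
  refine integral_congr_ae ?_
  filter_upwards [hf, hm.translate_tilde_ae_eq hK hg x] with y h1 h2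
  rw [h1, h2]

end NullSets

/-! ### Functionals on `L¹` and integrals of continuous families -/

section FunctionalsOnL1

theorem continuous_restrict {K : Type*} [TopologicalSpace K] {G : K → C(K, ℂ)} (hG : Continuous fun p : K × K => G p.1 p.2)
    (C : Set K) : Continuous fun t => (G t).restrict C :=
  ContinuousMap.continuous_of_continuous_uncurry _
    (hG.comp (continuous_fst.prodMk (continuous_subtype_val.comp continuous_snd)))

variable {K : Type*} [MeasurableSpace K] {m : Measure K}

open Classical in
/-- The value of a functional on `L¹` at the class of a function. -/
noncomputable def evalL1 (D : StrongDual ℂ (Lp ℂ 1 m)) (f : K → ℂ) : ℂ :=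
  if h : MemLp f 1 m then D (h.toLp f) else 0

theorem evalL1_eq (D : StrongDual ℂ (Lp ℂ 1 m)) {f : K → ℂ} (h : MemLp f 1 m) :
    evalL1 D f = D (h.toLp f) := dif_pos h

theorem evalL1_smul (D : StrongDual ℂ (Lp ℂ 1 m)) (c : ℂ) {f : K → ℂ} (h : MemLp f 1 m) :
    evalL1 D (c • f) = c * evalL1 D f := by
  rw [evalL1_eq D h, evalL1_eq D (h.const_smul c), MemLp.toLp_const_smul, map_smul, smul_eq_mul]

theorem norm_evalL1_le (D : StrongDual ℂ (Lp ℂ 1 m)) {f : K → ℂ} (h : MemLp f 1 m) :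
    ‖evalL1 D f‖ ≤ ‖D‖ * ∫ x, ‖f x‖ ∂m := by
  rw [evalL1_eq D h]
  refine (D.le_opNorm _).trans_eq ?_
  rw [L1.norm_eq_integral_norm]
  congr 1
  exact integral_congr_ae (h.coeFn_toLp.mono fun x hx => by simp only [hx])

variable [TopologicalSpace K] [T2Space K] [BorelSpace K] [IsFiniteMeasureOnCompacts m]

/-- Extension by zero maps `C(C, ℂ)` boundedly into `L¹`, as `m(C)` is finite. In the sup norm,
continuous families are Bochner integrable over compact sets, so `D` can be moved under the integral
there. -/
theorem exists_dual_evalL1_eq (D : StrongDual ℂ (Lp ℂ 1 m)) {C : Set K} (hC : IsCompact C) :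
    ∃ Ψ : StrongDual ℂ C(C, ℂ), ∀ f : C(K, ℂ), (∀ x, x ∉ C → f x = 0) →
      evalL1 D f = Ψ (f.restrict C) := by
  have : CompactSpace C := isCompact_iff_compactSpace.1 hC
  let E : C(C, ℂ) → K → ℂ := fun u => Function.extend Subtype.val u 0
  have hE1 : ∀ u (x : C), E u x = u x := fun u x => Subtype.val_injective.extend_apply _ _ _
  have hE0 : ∀ u (x : K), x ∉ C → E u x = 0 := fun u x hx =>
    Function.extend_apply' _ _ _ (by rintro ⟨y, rfl⟩; exact hx y.2)
  have hbound : ∀ u x, ‖E u x‖ ≤ C.indicator (fun _ => ‖u‖) x := fun u x => by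
    by_cases hx : x ∈ C
    · rw [Set.indicator_of_mem hx, hE1 u ⟨x, hx⟩]
      exact u.norm_coe_le_norm _
    · rw [hE0 u x hx, norm_zero, Set.indicator_of_notMem hx]
  have hind : ∀ c : ℝ, Integrable (C.indicator fun _ => c) m := fun c =>
    (integrable_indicator_iff hC.measurableSet).2 (integrableOn_const hC.measure_ne_top)
  have hmem : ∀ u, MemLp (E u) 1 m := fun u => by
    rw [memLp_one_iff_integrable]
    refine (hind ‖u‖).mono' ?_ (.of_forall (hbound u))
    exact ((MeasurableEmbedding.subtype_coe hC.measurableSet).stronglyMeasurable_extend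
      u.continuous.stronglyMeasurable stronglyMeasurable_zero).aestronglyMeasurable
  have hadd : ∀ u v, E (u + v) = E u + E v := fun u v => by
    ext x
    by_cases hx : x ∈ C
    · lift x to C using hx
      simp [hE1]
    · simp [hE0 _ x hx]
  have hsmul : ∀ (c : ℂ) u, E (c • u) = c • E u := fun c u => by
    ext x
    by_cases hx : x ∈ C
    · lift x to C using hx
      simp [hE1]
    · simp [hE0 _ x hx]
  let L : C(C, ℂ) →ₗ[ℂ] ℂ :=
    { toFun := fun u => evalL1 D (E u)
      map_add' := fun u v => by
        simp only [evalL1_eq D (hmem _)]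
        rw [← map_add, ← MemLp.toLp_add]
        congr 1
        exact MemLp.toLp_congr _ _ (.of_forall fun x => by rw [hadd])
      map_smul' := fun c u => by
        rw [hsmul, evalL1_smul D c (hmem u), RingHom.id_apply, smul_eq_mul] }
  refine ⟨L.mkContinuous (‖D‖ * m.real C) fun u => ?_, fun f hf => ?_⟩
  · refine (norm_evalL1_le D (hmem u)).trans ?_
    rw [mul_assoc]
    refine mul_le_mul_of_nonneg_left ?_ (norm_nonneg _)
    calc ∫ x, ‖E u x‖ ∂m ≤ ∫ x, C.indicator (fun _ => ‖u‖) x ∂m :=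
          integral_mono (memLp_one_iff_integrable.1 (hmem u)).norm (hind _) (hbound u)
      _ = m.real C * ‖u‖ := by
          rw [integral_indicator hC.measurableSet, setIntegral_const, smul_eq_mul]
  · change evalL1 D f = evalL1 D (E (f.restrict C))
    congr 1
    ext x
    by_cases hx : x ∈ C
    · rw [hE1 _ ⟨x, hx⟩]; rfl
    · rw [hE0 _ x hx, hf x hx]

theorem continuous_evalL1 [LocallyCompactSpace K] (D : StrongDual ℂ (Lp ℂ 1 m)) {G : K → C(K, ℂ)}
    (hG : Continuous fun p : K × K => G p.1 p.2)
    (hC : ∀ A, IsCompact A → ∃ C : Set K, IsCompact C ∧ ∀ t ∈ A, ∀ x, x ∉ C → G t x = 0) :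
    Continuous fun t => evalL1 D (G t) := by
  refine continuous_iff_continuousAt.2 fun t => ?_
  obtain ⟨A, hA, htA⟩ := exists_compact_mem_nhds t
  obtain ⟨C, hC, h⟩ := hC A hA
  obtain ⟨Ψ, hΨ⟩ := exists_dual_evalL1_eq D hC
  refine (Ψ.continuous.comp (continuous_restrict hG C)).continuousAt.congr ?_
  filter_upwards [htA] with s hs
  exact (hΨ (G s) (h s hs)).symm

/-- A functional on `L¹` commutes with integrals of continuous families of functions
with a common compact support. -/
theorem evalL1_integral (D : StrongDual ℂ (Lp ℂ 1 m)) {G : K → C(K, ℂ)}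
    (hG : Continuous fun p : K × K => G p.1 p.2) {A C : Set K} (hA : IsCompact A)
    (hC : IsCompact C) (h : ∀ t ∈ A, ∀ x, x ∉ C → G t x = 0) (μ : Measure K)
    [IsFiniteMeasureOnCompacts μ] {u : C(K, ℂ)} (hu : ∀ x, u x = ∫ t in A, G t x ∂μ) :
    evalL1 D u = ∫ t in A, evalL1 D (G t) ∂μ := by
  have : CompactSpace C := isCompact_iff_compactSpace.1 hC
  obtain ⟨Ψ, hΨ⟩ := exists_dual_evalL1_eq D hC
  have hi : IntegrableOn (fun t => (G t).restrict C) A μ :=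
    (continuous_restrict hG C).continuousOn.integrableOn_compact hA
  rw [hΨ u, setIntegral_congr_fun hA.measurableSet fun t ht => hΨ (G t) (h t ht),
    Ψ.integral_comp_comm hi]
  · congr 1
    ext x
    rw [ContinuousMap.restrict_apply, hu]
    exact (ContinuousMap.evalCLM ℂ x).integral_comp_comm hi
  · intro x hx
    rw [hu, setIntegral_congr_fun hA.measurableSet fun t ht => h t ht x hx, integral_zero]

end FunctionalsOnL1

/-! ### Density of `C_c(K)` in `L¹` -/

section Density

variable {K : Type*} [TopologicalSpace K] [T2Space K] [LocallyCompactSpace K]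
  [MeasurableSpace K] [BorelSpace K] {m : Measure K}

theorem eq_zero_of_forall_evalL1_eq_zero [IsFiniteMeasureOnCompacts m] [m.InnerRegular]
    (D : StrongDual ℂ (Lp ℂ 1 m))
    (h : ∀ f : K → ℂ, Continuous f → HasCompactSupport f → evalL1 D f = 0) : D = 0 := by
  have dense : ∀ f : Lp ℂ 1 m, ∀ ε : ℝ≥0∞, ε ≠ 0 → ∃ g : K → ℂ, eLpNorm (⇑f - g) 1 m ≤ ε ∧
      Continuous g ∧ HasCompactSupport g := by
    intro f ε hε
    refine (Lp.memLp f).induction_dense ENNReal.one_ne_top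
      (fun g => Continuous g ∧ HasCompactSupport g) ?_ ?_ ?_ hε
    · intro c s hs hms ε hε
      obtain ⟨η, hη, hηε⟩ := exists_eLpNorm_indicator_le (μ := m) ENNReal.one_ne_top c hε
      have hη2 : (η : ℝ≥0∞) / 2 ≠ 0 := (ENNReal.half_pos (by simpa using hη.ne')).ne'
      -- Inner regularity replaces `s` by a compact `L`, and only `L` is approximated from outside
      -- by an open set. The cutoff differs from the indicator of `s` only on `(s \ L) ∪ (U \ L)`.
      obtain ⟨L, hLs, hL, -, hmL⟩ := hs.exists_isCompact_isClosed_sdiff_lt hms.ne hη2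
      obtain ⟨U, hLU, hU, hmU⟩ := hL.exists_isOpen_lt_add (μ := m) hη2
      have hUL : m (U \ L) < (η : ℝ≥0∞) / 2 :=
        measure_sdiff_lt_of_lt_add hL.measurableSet.nullMeasurableSet hLU hL.measure_ne_top hmU
      obtain ⟨r, hr, hr1⟩ := exists_isCutoff hL hU hLU
      refine ⟨fun x => (r x : ℂ) * c, ?_,
        (Complex.continuous_ofReal.comp hr.continuous).mul continuous_const, ?_⟩
      · refine le_trans (eLpNorm_mono fun x => ?_) (hηε ((s \ L) ∪ (U \ L)) ?_)
        · by_cases hxL : x ∈ L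
          · simp [hr1 x hxL, hLs hxL]
          · by_cases hxs : x ∈ s
            · have h1 : (r x : ℂ) * c - c = ((r x - 1 : ℝ) : ℂ) * c := by push_cast; ring
              have h2 : |r x - 1| ≤ 1 := by
                rw [abs_le]; constructor <;> linarith [hr.nonneg x, hr.le_one x]
              simp only [Pi.sub_apply, Set.indicator_of_mem hxs, h1, norm_mul, Complex.norm_real,
                Real.norm_eq_abs,
                Set.indicator_of_mem (show x ∈ (s \ L) ∪ (U \ L) from .inl ⟨hxs, hxL⟩)]
              exact mul_le_of_le_one_left (norm_nonneg _) h2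
            · by_cases hxU : x ∈ U
              · simp only [Pi.sub_apply, Set.indicator_of_notMem hxs, sub_zero, norm_mul,
                  Complex.norm_real, Real.norm_eq_abs, abs_of_nonneg (hr.nonneg x),
                  Set.indicator_of_mem (show x ∈ (s \ L) ∪ (U \ L) from .inr ⟨hxU, hxL⟩)]
                exact mul_le_of_le_one_left (norm_nonneg _) (hr.le_one x)
              · simp [hr.eq_zero x hxU, hxs]
        · refine (measure_union_le _ _).trans ?_
          rw [← ENNReal.add_halves (η : ℝ≥0∞)]
          exact add_le_add hmL.le hUL.le
      · exact (hr.hasCompactSupport.comp_left (g := ((↑) : ℝ → ℂ)) Complex.ofReal_zero).mul_right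
    · rintro f g ⟨hf, hf'⟩ ⟨hg, hg'⟩
      exact ⟨hf.add hg, hf'.add hg'⟩
    · rintro f ⟨hf, hf'⟩
      exact (hf.integrable_of_hasCompactSupport hf').aestronglyMeasurable
  ext f
  rw [zero_apply, ← norm_le_zero_iff]
  refine le_of_forall_pos_le_add fun δ hδ => ?_
  have hpos : 0 < δ / (‖D‖ + 1) := by positivity
  obtain ⟨g, hfg, hg, hgc⟩ := dense f (ENNReal.ofReal (δ / (‖D‖ + 1))) (by simpa using hpos)
  have hgm : MemLp g 1 m := memLp_one_iff_integrable.2 (hg.integrable_of_hasCompactSupport hgc)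
  have h0 := h g hg hgc
  rw [evalL1_eq D hgm] at h0
  have hn : ‖f - hgm.toLp g‖ ≤ δ / (‖D‖ + 1) := by
    refine ENNReal.toReal_le_of_le_ofReal hpos.le (le_trans (le_of_eq ?_) hfg)
    refine eLpNorm_congr_ae ?_
    filter_upwards [Lp.coeFn_sub f (hgm.toLp g), hgm.coeFn_toLp] with x h1 h2
    rw [h1, Pi.sub_apply, Pi.sub_apply, h2]
  calc ‖D f‖ = ‖D (f - hgm.toLp g)‖ := by rw [map_sub, h0, sub_zero]
    _ ≤ ‖D‖ * (δ / (‖D‖ + 1)) := D.le_opNorm_of_le hn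
    _ ≤ (‖D‖ + 1) * (δ / (‖D‖ + 1)) := by gcongr; linarith
    _ = 0 + δ := by rw [zero_add]; field_simp

end Density

/-! ### Characters and the Fourier transform -/

section Characters

theorem fourier_congr {K : Type*} [TopologicalSpace K] [MeasurableSpace K] {m : Measure K}
    {α : K →ᵇ ℂ} {f g : K → ℂ} (h : f =ᵐ[m] g) : fourier m f α = fourier m g α :=
  integral_congr_ae (h.mono fun x hx => by simp only [hx])

variable {K : Type*} [TopologicalSpace K] [T2Space K] [LocallyCompactSpace K]
  [MeasurableSpace K] [BorelSpace K] [Hypergroup K] {m : Measure K} {α : K →ᵇ ℂ}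

theorem IsCharacter.T_eq (hα : IsCharacter α) (x y : K) : T x α y = α x * α y :=
  hα.integral_ω x y

theorem IsCharacter.apply_e_ne_zero (hα : IsCharacter α) : α e ≠ 0 := by
  intro h0
  refine hα.ne_zero ?_
  ext x
  have := hα.integral_ω x e
  rwa [ω_e, integral_dirac, h0, mul_zero] at this

theorem IsHaarMeasure.memLp_one (hm : IsHaarMeasure m) {f : K →ᵇ ℂ} (hf : HasCompactSupport f) :
    MemLp f 1 m :=
  memLp_one_iff_integrable.2 (hm.integrable hf)

/-- The adjoint formula moves the translation onto `conj α`, and `T_x̃ (conj α) = α(x) conj α`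
because `α` is hermitian. -/
theorem IsCharacter.fourier_T (hα : IsCharacter α) (hm : IsHaarMeasure m) (hK : IsCommutative K)
    {f : K →ᵇ ℂ} (hf : HasCompactSupport f) (x : K) :
    fourier m (T x f) α = α x * fourier m f α := by
  have h1 : ∀ y, T (tilde x) (star α) y = α x * conj (α y) := fun y => by
    rw [T_apply]
    simp only [BoundedContinuousFunction.star_apply, RCLike.star_def]
    rw [integral_conj, hα.integral_ω, hα.map_tilde, map_mul, Complex.conj_conj]
  have h2 := hm.integral_T_mul hK hf (star α) x
  simp only [h1, BoundedContinuousFunction.star_apply, RCLike.star_def] at h2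
  rw [fourier, fourier, ← integral_const_mul]
  simp_rw [mul_comm (conj (α _))]
  rw [h2]
  congr 1; ext y; ring

/-- For a cutoff `χ` with `χ(e) = 1`, the transform of `α χ` at `α` is `∫ |α|² χ dm`, positive since
`α(e) ≠ 0`; normalize. -/
theorem IsCharacter.exists_fourier_eq_one (hα : IsCharacter α) (hm : IsHaarMeasure m) :
    ∃ g : K →ᵇ ℂ, HasCompactSupport g ∧ fourier m g α = 1 := by
  obtain ⟨χ, r, hr, -, hχ, hχr, hr0, -, hr1, -⟩ := exists_urysohn
    (isCompact_singleton (x := (e : K))) isOpen_univ (Set.subset_univ _)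
  have hF : ∀ x, (star α * (α * χ)) x = ((‖α x‖ ^ 2 * r x : ℝ) : ℂ) := fun x => by
    simp only [BoundedContinuousFunction.mul_apply, BoundedContinuousFunction.star_apply,
      RCLike.star_def, hχr]
    rw [← mul_assoc, Complex.conj_mul']
    push_cast; rfl
  have hpos := hm.integral_pos (f := star α * (α * χ)) (hχ.mul_left.mul_left) hF
    ((α.continuous.norm.pow 2).mul hr) (fun x => mul_nonneg (by positivity) (hr0 x))
    (by rw [hr1 e rfl, mul_one]; exact pow_pos (norm_pos_iff.2 hα.apply_e_ne_zero) 2)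
  set c := ∫ x, ‖α x‖ ^ 2 * r x ∂m with hc
  refine ⟨(c⁻¹ : ℂ) • (α * χ), (hχ.mul_left (f := α)).smul_left (f := fun _ => (c⁻¹ : ℂ)), ?_⟩
  calc fourier m ((c⁻¹ : ℂ) • (α * χ) : K →ᵇ ℂ) α
      = ∫ x, (c⁻¹ : ℂ) * ((‖α x‖ ^ 2 * r x : ℝ) : ℂ) ∂m := by
        refine integral_congr_ae (.of_forall fun x => ?_)
        simp only [← hF, BoundedContinuousFunction.mul_apply, BoundedContinuousFunction.star_apply,
          RCLike.star_def, BoundedContinuousFunction.coe_smul, smul_eq_mul]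
        ring
    _ = 1 := by
        rw [integral_const_mul, integral_complex_ofReal, ← hc,
          inv_mul_cancel₀ (Complex.ofReal_ne_zero.2 hpos.ne')]

theorem IsHaarMeasure.integral_norm_T_le (hm : IsHaarMeasure m) {f : K →ᵇ ℂ}
    (hf : HasCompactSupport f) (x : K) : ∫ y, ‖T x f y‖ ∂m ≤ ∫ y, ‖f y‖ ∂m := by
  have hc : HasCompactSupport fun y => ((‖f y‖ : ℝ) : ℂ) :=
    hf.comp_left (g := fun z : ℂ => ((‖z‖ : ℝ) : ℂ)) (by simp)
  obtain ⟨F, hF⟩ := exists_boundedContinuous_eq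
    (Complex.continuous_ofReal.comp f.continuous.norm) hc
  have hF' : ∀ y, F y = (‖f y‖ : ℝ) := fun y => by rw [hF]; rfl
  have hFc : HasCompactSupport F := by rw [hF]; exact hc
  rw [← hm.integral_T_ofReal x hFc hF']
  exact integral_mono (hm.integrable (hasCompactSupport_T x hf)).norm
    (hm.integrable_integral_ofReal hFc hF' x) fun y => norm_integral_le_integral_norm _

end Characters

/-! ### Convolution of compactly supported functions -/

section Convolution

variable {K : Type*} [TopologicalSpace K] [T2Space K] [LocallyCompactSpace K]
  [MeasurableSpace K] [BorelSpace K] [Hypergroup K] {m : Measure K}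

theorem exists_isCompact_T_tilde_eq_zero {A : Set K} (hA : IsCompact A) {g : K →ᵇ ℂ}
    (hg : HasCompactSupport g) :
    ∃ C : Set K, IsCompact C ∧ ∀ y ∈ A, ∀ x, x ∉ C → T (tilde y) g x = 0 := by
  obtain ⟨C, hC, h⟩ := exists_isCompact_T_eq_zero (hA.image continuous_tilde) hg
  exact ⟨C, hC, fun y hy => h _ ⟨y, hy, rfl⟩⟩

theorem IsHaarMeasure.exists_eq_convolution (hm : IsHaarMeasure m) {f g : K →ᵇ ℂ}
    (hf : HasCompactSupport f) (hg : HasCompactSupport g) :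
    ∃ k : K →ᵇ ℂ, HasCompactSupport k ∧ ⇑k = convolution m f g := by
  have := hm.isFiniteMeasureOnCompacts
  obtain ⟨C, hC, h⟩ := exists_isCompact_T_tilde_eq_zero hf.isCompact hg
  have hc : Continuous (convolution m f g) := by
    rw [← continuousOn_univ]
    refine continuousOn_integral_of_compact_support hf.isCompact ?_ fun p z _ hz => ?_
    · exact ((f.continuous.comp continuous_snd).mul ((continuous_T g).comp
        ((continuous_tilde.comp continuous_snd).prodMk continuous_fst))).continuousOn
    · rw [image_eq_zero_of_notMem_tsupport hz, zero_mul]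
  have hs : HasCompactSupport (convolution m f g) := by
    refine HasCompactSupport.intro hC fun x hx => ?_
    refine integral_eq_zero_of_ae (.of_forall fun y => ?_)
    change f y * T (tilde y) g x = 0
    by_cases hy : y ∈ tsupport f
    · simp [h y hy x hx]
    · simp [image_eq_zero_of_notMem_tsupport hy]
  obtain ⟨k, hk⟩ := exists_boundedContinuous_eq hc hs
  exact ⟨k, by rwa [hk], hk⟩

/-- Commutativity writes `(f * g)(z)` as the pairing of `f` with the reflection of `T_z g`. The
adjoint formula moves `T_x` across as `T_x̃`, which reflection turns back into `T_x`. -/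
theorem IsHaarMeasure.convolution_T_left (hm : IsHaarMeasure m) (hK : IsCommutative K)
    {f : K →ᵇ ℂ} (hf : HasCompactSupport f) (g : K →ᵇ ℂ) (x : K) :
    convolution m (T x f) g = convolution m f (T x g) := by
  ext z
  have h1 : ∀ k : K →ᵇ ℂ, ∀ y, translate (tilde y) k z = reflect (T z k) y := fun k y => by
    rw [translate_eq_T, reflect_apply, T_comm hK]
  simp only [convolution, h1]
  rw [hm.integral_T_mul hK hf, ← reflect_T hK, T_T_comm hK]

end Convolution

/-! ### Derivations at an amenable character -/

section Derivations

variable {K : Type*} [TopologicalSpace K] [T2Space K] [LocallyCompactSpace K]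
  [MeasurableSpace K] [BorelSpace K] [Hypergroup K] {m : Measure K} {α : K →ᵇ ℂ}
  {D : StrongDual ℂ (Lp ℂ 1 m)}

theorem IsDerivation.evalL1_convolution (hD : IsDerivation m α D) (hm : IsHaarMeasure m)
    (hK : IsCommutative K) {f g : K →ᵇ ℂ} (hf : HasCompactSupport f) (hg : HasCompactSupport g) :
    evalL1 D (convolution m f g) = fourier m f α * evalL1 D g + fourier m g α * evalL1 D f := by
  obtain ⟨k, hk, hkc⟩ := hm.exists_eq_convolution hf hg
  have hf1 := hm.memLp_one hf
  have hg1 := hm.memLp_one hg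
  have hk1 := hm.memLp_one hk
  have h := hD (hf1.toLp f) (hg1.toLp g) (hk1.toLp k) (by
    rw [hm.convolution_congr hK hf1.coeFn_toLp hg1.coeFn_toLp, ← hkc]
    exact hk1.coeFn_toLp)
  rwa [fourier_congr hf1.coeFn_toLp, fourier_congr hg1.coeFn_toLp, ← evalL1_eq, ← evalL1_eq,
    ← evalL1_eq, hkc] at h

theorem IsDerivation.evalL1_T (hD : IsDerivation m α D) (hm : IsHaarMeasure m)
    (hK : IsCommutative K) (hα : IsCharacter α) {f g : K →ᵇ ℂ} (hf : HasCompactSupport f)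
    (hg : HasCompactSupport g) (hg1 : fourier m g α = 1) (x : K) :
    evalL1 D (T x f) =
      α x * evalL1 D f + fourier m f α * (evalL1 D (T x g) - α x * evalL1 D g) := by
  have h1 := hD.evalL1_convolution hm hK (hasCompactSupport_T x hf) hg
  have h2 := hD.evalL1_convolution hm hK hf (hasCompactSupport_T x hg)
  rw [hm.convolution_T_left hK hf, h2, hα.fourier_T hm hK hf, hα.fourier_T hm hK hg, hg1] at h1
  linear_combination -h1

theorem evalL1_T_T (D : StrongDual ℂ (Lp ℂ 1 m)) (hm : IsHaarMeasure m) {g : K →ᵇ ℂ}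
    (hg : HasCompactSupport g) (x y : K) :
    evalL1 D (T y (T x g)) = ∫ t, evalL1 D (T t g) ∂(ω x y) := by
  have := hm.isFiniteMeasureOnCompacts
  obtain ⟨C, hC, h⟩ := exists_isCompact_T_eq_zero (isCompact_support_ω x y) hg
  have hr : (ω x y).restrict (ω x y).support = ω x y :=
    Measure.restrict_eq_self_of_ae_mem (ae_mem_support x y)
  have := evalL1_integral D (G := fun t => (T t g).toContinuousMap)
    (u := (T y (T x g)).toContinuousMap) (continuous_T g) (isCompact_support_ω x y) hC h (ω x y)
    (fun z => by rw [hr]; exact T_T_apply y x z g)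
  rwa [hr] at this

theorem IsHaarMeasure.norm_evalL1_T_le (hm : IsHaarMeasure m) (D : StrongDual ℂ (Lp ℂ 1 m))
    {g : K →ᵇ ℂ} (hg : HasCompactSupport g) (x : K) :
    ‖evalL1 D (T x g)‖ ≤ ‖D‖ * ∫ y, ‖g y‖ ∂m :=
  (norm_evalL1_le D (hm.memLp_one (hasCompactSupport_T x hg))).trans
    (mul_le_mul_of_nonneg_left (hm.integral_norm_T_le hg x) (norm_nonneg _))

theorem exists_boundedContinuous_evalL1_T (D : StrongDual ℂ (Lp ℂ 1 m)) (hm : IsHaarMeasure m)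
    {g : K →ᵇ ℂ} (hg : HasCompactSupport g) : ∃ ψ : K →ᵇ ℂ, ∀ x, ψ x = evalL1 D (T x g) := by
  have := hm.isFiniteMeasureOnCompacts
  exact ⟨BoundedContinuousFunction.ofNormedAddCommGroup (fun x => evalL1 D (T x g))
    (continuous_evalL1 D (G := fun t => (T t g).toContinuousMap) (continuous_T g)
      fun A hA => exists_isCompact_T_eq_zero hA hg) _ (hm.norm_evalL1_T_le D hg), fun x => rfl⟩

/-- An amenable character admits no nonzero bounded solution `φ` of
`T_x φ = α(x) φ + φ(x) α`. -/
theorem IsAmenable.eq_zero (hamen : IsAmenable m α) (hm : IsHaarMeasure m) {φ : K →ᵇ ℂ}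
    (hφ : ∀ x y, T x φ y = α x * φ y + φ x * α y) (x : K) : φ x = 0 := by
  obtain ⟨M, hM1, hM⟩ := hamen
  have hcoe : ∀ f : K →ᵇ ℂ, toLinfty m f =ᵐ[m] f := fun f => MemLp.coeFn_toLp _
  have h := hM x (toLinfty m φ) (α x • toLinfty m φ + φ x • toLinfty m α) (by
    refine Filter.EventuallyEq.trans ?_ (hm.translate_ae_eq (hcoe φ) x).symm
    filter_upwards [Lp.coeFn_add (α x • toLinfty m φ) (φ x • toLinfty m α),
      Lp.coeFn_smul (α x) (toLinfty m φ), Lp.coeFn_smul (φ x) (toLinfty m α), hcoe φ, hcoe α]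
      with y h1 h2 h3 h4 h5
    rw [h1, Pi.add_apply, h2, h3, Pi.smul_apply, Pi.smul_apply, h4, h5, translate_eq_T, hφ,
      smul_eq_mul, smul_eq_mul])
  rw [map_add, map_smul, map_smul, hM1, smul_eq_mul, smul_eq_mul, mul_one] at h
  exact add_eq_left.1 h

theorem IsDerivation.evalL1_T_eq_mul (hD : IsDerivation m α D) (hm : IsHaarMeasure m)
    (hK : IsCommutative K) (hα : IsCharacter α) (hamen : IsAmenable m α) {g : K →ᵇ ℂ}
    (hg : HasCompactSupport g) (hg1 : fourier m g α = 1) (x : K) :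
    evalL1 D (T x g) = α x * evalL1 D g := by
  obtain ⟨ψ, hψ⟩ := exists_boundedContinuous_evalL1_T D hm hg
  have key := hamen.eq_zero hm (φ := ψ - evalL1 D g • α) (fun x y => ?_) x
  · simp only [BoundedContinuousFunction.coe_sub, BoundedContinuousFunction.coe_smul, Pi.sub_apply,
      hψ, smul_eq_mul] at key
    linear_combination key
  · have h1 : T x (ψ - evalL1 D g • α) y = evalL1 D (T y (T x g)) - evalL1 D g * (α x * α y) := by
      rw [evalL1_T_T D hm hg, ← hα.integral_ω, ← integral_const_mul, T_apply]
      simp_rw [← hψ]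
      rw [← integral_sub (integrable_ω ψ x y) ((integrable_ω α x y).const_mul _)]
      rfl
    -- The translation formula for `D` is used at `f = T_x g`, whose transform at `α` is `α(x)`.
    rw [h1, hD.evalL1_T hm hK hα (hasCompactSupport_T x hg) hg hg1, hα.fourier_T hm hK hg, hg1]
    simp only [BoundedContinuousFunction.coe_sub, BoundedContinuousFunction.coe_smul, Pi.sub_apply,
      hψ, smul_eq_mul]
    ring

/-- `f * g` is the integral of `f(y) T_ỹ g` over `y`. Under the integral `D` produces `α(ỹ) = conj
α(y)`, the kernel of the Fourier transform. -/
theorem evalL1_convolution_of_evalL1_T (hm : IsHaarMeasure m) (hα : IsCharacter α)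
    {f g : K →ᵇ ℂ} (hf : HasCompactSupport f) (hg : HasCompactSupport g)
    (h : ∀ x, evalL1 D (T x g) = α x * evalL1 D g) :
    evalL1 D (convolution m f g) = fourier m f α * evalL1 D g := by
  have := hm.isFiniteMeasureOnCompacts
  obtain ⟨k, -, hkc⟩ := hm.exists_eq_convolution hf hg
  obtain ⟨C, hC, hCs⟩ := exists_isCompact_T_tilde_eq_zero hf.isCompact hg
  have hsupp : ∀ u : K → ℂ, ∫ y in tsupport f, f y * u y ∂m = ∫ y, f y * u y ∂m := fun u =>
    setIntegral_eq_integral_of_forall_compl_eq_zero fun y hy => by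
      rw [image_eq_zero_of_notMem_tsupport hy, zero_mul]
  have key := evalL1_integral D (G := fun y => (f y • T (tilde y) g).toContinuousMap)
    (u := k.toContinuousMap) ?_ hf.isCompact hC (fun y hy x hx => ?_) m (fun x => ?_)
  · rw [← hkc]
    refine key.trans ?_
    have h1 : ∀ y, evalL1 D (f y • T (tilde y) g).toContinuousMap =
        f y * (conj (α y) * evalL1 D g) := fun y => by
      rw [← hα.map_tilde, ← h]
      exact evalL1_smul D (f y) (hm.memLp_one (hasCompactSupport_T (tilde y) hg))
    simp_rw [h1]
    rw [hsupp, fourier, ← integral_mul_const]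
    congr 1; ext y; ring
  · exact (f.continuous.comp continuous_fst).mul ((continuous_T g).comp
        ((continuous_tilde.comp continuous_fst).prodMk continuous_snd))
  · change f y * T (tilde y) g x = 0
    rw [hCs y hy x hx, mul_zero]
  · change k x = ∫ y in tsupport f, f y * T (tilde y) g x ∂m
    rw [hsupp, hkc]
    rfl

theorem IsDerivation.evalL1_eq_zero (hD : IsDerivation m α D) (hm : IsHaarMeasure m)
    (hK : IsCommutative K) (hα : IsCharacter α) (hamen : IsAmenable m α) {f : K →ᵇ ℂ}
    (hf : HasCompactSupport f) : evalL1 D f = 0 := by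
  obtain ⟨g, hg, hg1⟩ := hα.exists_fourier_eq_one hm
  have h1 := evalL1_convolution_of_evalL1_T hm hα hf hg
    (hD.evalL1_T_eq_mul hm hK hα hamen hg hg1)
  rw [hD.evalL1_convolution hm hK hf hg, hg1] at h1
  linear_combination h1

end Derivations

end Hypergroup

theorem mainTheorem9 {K : Type*} [TopologicalSpace K] [T2Space K] [LocallyCompactSpace K]
    [MeasurableSpace K] [BorelSpace K] [Hypergroup K]
    (hK : Hypergroup.IsCommutative K)
    (m : Measure K) (hm : Hypergroup.IsHaarMeasure m)
    (α : K →ᵇ ℂ) (hα : Hypergroup.IsCharacter α)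
    (hamen : Hypergroup.IsAmenable m α)
    (D : StrongDual ℂ (Lp ℂ 1 m)) (hD : Hypergroup.IsDerivation m α D) :
    D = 0 := by
  have := hm.isFiniteMeasureOnCompacts
  have := hm.innerRegular
  refine Hypergroup.eq_zero_of_forall_evalL1_eq_zero D fun f hf hfc => ?_
  obtain ⟨F, rfl⟩ := Hypergroup.exists_boundedContinuous_eq hf hfc
  exact hD.evalL1_eq_zero hm hK hα hamen hfc
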